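/- **Setting.** Fix $n\ge 1$ offline nodes $[n]$. A request sequence $E=((N_t,q_t))_{t\in[m]}$ consists of $m$ online nodes with non-empty neighborhoods $N_t\subseteq[n]$ and quantities $q_t>0$. A feasible allocation of online node $t$ is a vector $x_t\in\mathbb{R}_{\ge0}^n$ with $x_t(i)=0$ for $i\notin N_t$ and $\sum_i x_t(i)=q_t$; $\Delta(E)$ is the set of all load vectors $\sum_t x_t$ with every $x_t$ feasible. An online policy $\mathcal A$, possibly randomized, selects a feasible $x_t$ from the past requests, its past allocations and the current request $(N_t,q_t)$; $\mathcal A(E)=\sum_t x_t$ is its final load vector. Water-filling $\mathrm{WF}$ is the deterministic policy that selects the feasible $x_t$ maximizing $\min_{i\in N_t}\bigl(x_t(i)+\sum_{s<t}x_s(i)\bigr)$. Let $\mathrm{NSW}(\ell)=\bigl(\prod_{i\in[n]}\ell(i)\bigr)^{1/n}$. The competitive ratio $\mathrm{CR}_n(\mathcal A)$ of a policy for maximizing Nash social welfare is the largest $\alpha>0$ (and $0$ if there is none) such that $$\alpha\cdot\max_{\ell\in\Delta(E)}\mathrm{NSW}(\ell)-\mathbb{E}\,[\mathrm{NSW}(\mathcal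 A(E))]\le 0$$ for every request sequence $E$ with any number $m\geq 1$ of online nodes and any total quantity $q=\sum_t q_t>0$ (oblivious adversary). Against an adaptive adversary, who chooses the $t$-th online node as a function of the previous online nodes and allocations, with the number of rounds and (almost surely) the total quantity fixed, $\mathrm{CR}^{\mathrm{ad}}_n(\mathcal A)$ is defined in the same way with $\mathbb{E}\,[\alpha\cdot\max_{\ell\in\Delta(E)}\mathrm{NSW}(\ell)-\mathrm{NSW}(\mathcal A(E))]\le 0$, where $E$ is the realized request sequence. **Lemma (NSW competitive ratio).** For every $n\ge1$, water-filling attains the minimax-optimal competitive ratio for Nash social welfare: for every (possibly randomized) policy $\mathcal A$, $$\mathrm{CR}_n(\mathcal A)\le \mathrm{CR}_n(\mathrm{WF})\quad\text{and}\quad \mathrm{CR}^{\mathrm{ad}}_n(\mathcal A)\le \mathrm{CR}^{\mathrm{ad}}_n(\mathrm{WF}).$$ Moreover $$\mathrm{CR}_n(\mathrm{WF})=\mathrm{CR}^{\mathrm{ad}}_n(\mathrm{WF})=\left(\frac1{n!}\right)^{1/n},\qquad \lim_{n\to\infty} n\cdot \mathrm{CR}_n(\mathrm{WF})=e .$$ 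-/

import Mathlib

open MeasureTheory Filter Topology
open scoped NNReal ENNReal Pointwise Nat

universe u

noncomputable section

namespace OnlineAllocation

/-- An online node: a (non-empty) set of compatible offline nodes and a positive divisible quantity.
The offline nodes are the elements of `Fin n`. -/
structure Request (n : ℕ) where
  nbrs : Finset (Fin n)
  qty : ℝ
  nbrs_nonempty : nbrs.Nonempty
  qty_pos : 0 < qty

/-- The feasible allocations `Δ(N, q)` of an online node: nonnegative vectors supported on the
neighborhood which distribute the full quantity. -/
def Request.allocations {n : ℕ} (r : Request n) : Set (Fin n → ℝ) :=
  {x | (∀ i, 0 ≤ x i) ∧ (∀ i, i ∉ r.nbrs → x i = 0) ∧ ∑ i, x i = r.qty}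

/-- The request sequences with `n` offline nodes, `m` online nodes and total quantity `q`. -/
def requestSeqs (n m : ℕ) (q : ℝ) : Set (List (Request n)) :=
  {E | E.length = m ∧ (E.map Request.qty).sum = q}

/-- The set `Δ(E)` of load vectors that are feasible in hindsight: the Minkowski sum of the sets
of feasible allocations of the online nodes. -/
def feasibleLoads {n : ℕ} (E : List (Request n)) : Set (Fin n → ℝ) :=
  (E.map Request.allocations).sum

/-- The optimal hindsight value of the objective `f` on `E`. (The supremum is a maximum when `f`
is continuous on the nonnegative orthant, since `Δ(E)` is compact and non-empty.) -/
def optValue {n : ℕ} (f : (Fin n → ℝ) → ℝ) (E : List (Request n)) : ℝ :=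
  sSup (f '' feasibleLoads E)

/-- The past online nodes with the allocations chosen for them, in order of arrival. -/
abbrev History (n : ℕ) := List (Request n × (Fin n → ℝ))

/-- The load vector accumulated along a history. -/
def History.load {n : ℕ} (h : History n) : Fin n → ℝ := (h.map Prod.snd).sum

/-- The request sequence of a history. -/
def History.requests {n : ℕ} (h : History n) : List (Request n) := h.map Prod.fst

/-- A deterministic online policy: from the history of arrivals and decisions and the current
online node, it selects a feasible allocation of that node. -/
structure Policy (n : ℕ) where
  alloc : History n → Request n → (Fin n → ℝ)
  feasible : ∀ h r, alloc h r ∈ r.allocations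

/-- The history produced by a policy on a fixed request sequence. -/
def Policy.run {n : ℕ} (A : Policy n) (E : List (Request n)) : History n :=
  E.foldl (fun h r => h ++ [(r, A.alloc h r)]) []

/-- The final load vector `A(E)` of a policy on a fixed request sequence. -/
def Policy.load {n : ℕ} (A : Policy n) (E : List (Request n)) : Fin n → ℝ := (A.run E).load

/-- A randomized online policy: a probability space (the coin flips of the policy) and, for each
outcome, an online policy, such that the load vector on each request sequence
(in particular on each prefix of a request sequence) is a random vector. -/
structure RandomizedPolicy (n : ℕ) where
  Seed : Type u
  [measurableSpace : MeasurableSpace Seed]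
  law : Measure Seed
  [isProbabilityMeasure : IsProbabilityMeasure law]
  policy : Seed → Policy n
  measurable_load : ∀ E : List (Request n), Measurable fun ω => (policy ω).load E

attribute [instance] RandomizedPolicy.measurableSpace RandomizedPolicy.isProbabilityMeasure

/-- A deterministic policy as a randomized policy which does not use its coin flips. -/
def Policy.toRandomized {n : ℕ} (A : Policy n) : RandomizedPolicy.{0} n where
  Seed := Unit
  law := Measure.dirac ()
  policy := fun _ => A
  measurable_load := fun _ => measurable_const

/-! ### Water-filling -/

/-- The smallest load among the neighbors of `r` if `x` is added to the load vector `l`. -/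
def minNbrLoad {n : ℕ} (r : Request n) (l x : Fin n → ℝ) : ℝ :=
  r.nbrs.inf' r.nbrs_nonempty fun i => x i + l i

theorem Request.isCompact_allocations {n : ℕ} (r : Request n) : IsCompact r.allocations := by
  have hsub : r.allocations ⊆ Set.univ.pi fun _ : Fin n => Set.Icc (0 : ℝ) r.qty := by
    rintro x ⟨h0, -, hs⟩ i -
    exact ⟨h0 i, hs ▸ Finset.single_le_sum (fun j _ => h0 j) (Finset.mem_univ i)⟩
  refine (isCompact_univ_pi fun _ => isCompact_Icc).of_isClosed_subset ?_ hsub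
  have h1 : IsClosed {x : Fin n → ℝ | ∀ i, 0 ≤ x i} := by
    simp only [Set.ofPred_forall]
    exact isClosed_iInter fun i => isClosed_le continuous_const (continuous_apply i)
  have h2 : IsClosed {x : Fin n → ℝ | ∀ i, i ∉ r.nbrs → x i = 0} := by
    simp only [Set.ofPred_forall]
    exact isClosed_iInter fun i => isClosed_iInter fun _ =>
      isClosed_eq (continuous_apply i) continuous_const
  have h3 : IsClosed {x : Fin n → ℝ | ∑ i, x i = r.qty} :=
    isClosed_eq (continuous_finsetSum _ fun i _ => continuous_apply i) continuous_const
  exact h1.inter (h2.inter h3)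

theorem Request.nonempty_allocations {n : ℕ} (r : Request n) : r.allocations.Nonempty := by
  obtain ⟨j, hj⟩ := r.nbrs_nonempty
  refine ⟨Pi.single j r.qty, fun i => ?_, fun i hi => ?_, ?_⟩
  · by_cases h : i = j
    · subst h; simpa using r.qty_pos.le
    · simp [h]
  · have h : i ≠ j := fun h => hi (h ▸ hj)
    simp [h]
  · simp

theorem exists_isMaxOn_minNbrLoad {n : ℕ} (r : Request n) (l : Fin n → ℝ) :
    ∃ x ∈ r.allocations, IsMaxOn (minNbrLoad r l) r.allocations x :=
  r.isCompact_allocations.exists_isMaxOn r.nonempty_allocations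
    (Continuous.finset_inf'_apply r.nbrs_nonempty fun i _ =>
      (continuous_apply i).add continuous_const).continuousOn

/-- Water-filling: the arriving quantity is allocated so as to maximize the minimum load among the
neighbors of the arriving node. (The maximizer is unique, so that there is nothing to choose.) -/
def waterFilling (n : ℕ) : Policy n where
  alloc h r := (exists_isMaxOn_minNbrLoad r h.load).choose
  feasible h r := (exists_isMaxOn_minNbrLoad r h.load).choose_spec.1

/-! ### Oblivious adversaries -/

/-- The cost `α * max f - 𝔼 f(A(E))` incurred by `A` on the request sequence `E`. -/
def cost {n : ℕ} (α : ℝ) (f : (Fin n → ℝ) → ℝ) (A : RandomizedPolicy.{u} n)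
    (E : List (Request n)) : ℝ :=
  α * optValue f E - ∫ ω, f ((A.policy ω).load E) ∂A.law

/-- The worst-case `α`-regret of `A`, over any number `m` of online nodes and any total
quantity `q > 0`. -/
def regret {n : ℕ} (α : ℝ) (f : (Fin n → ℝ) → ℝ) (A : RandomizedPolicy.{u} n) : EReal :=
  ⨆ (m : ℕ) (q : ℝ) (_ : 0 < q) (E ∈ requestSeqs n m q), (cost α f A E : EReal)

/-- The competitive ratio of `A` for maximizing `f`: the largest `α > 0` for which the `α`-regret
of `A` is at most `0` (and `0` if there is no such `α`). -/
def competitiveRatio {n : ℕ} (f : (Fin n → ℝ) → ℝ) (A : RandomizedPolicy.{u} n) : ℝ≥0∞ :=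
  ⨆ (α : ℝ≥0) (_ : 0 < α) (_ : regret α f A ≤ 0), (α : ℝ≥0∞)

/-! ### Adaptive adversaries -/

/-- An adaptive request sequence: from the past online nodes and the allocations observed on them,
the adversary designs the next online node. -/
abbrev AdaptiveSeq (n : ℕ) := History n → Request n

/-- The history of the first `m` rounds of a policy against an adaptive request sequence. -/
def Policy.play {n : ℕ} (A : Policy n) (E : AdaptiveSeq n) : ℕ → History n
  | 0 => []
  | m + 1 => A.play E m ++ [(E (A.play E m), A.alloc (A.play E m) (E (A.play E m)))]

/-- The adaptive request sequences which, when played for `m` rounds against `A`, have total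
quantity `q` almost surely and for which the expected hindsight optimum and the expected value
of `A` exist. -/
def adaptiveSeqs {n : ℕ} (f : (Fin n → ℝ) → ℝ) (A : RandomizedPolicy.{u} n) (m : ℕ) (q : ℝ) :
    Set (AdaptiveSeq n) :=
  {E | (∀ᵐ ω ∂A.law, ((A.policy ω).play E m).requests ∈ requestSeqs n m q) ∧
    Integrable (fun ω => optValue f ((A.policy ω).play E m).requests) A.law ∧
    Integrable (fun ω => f ((A.policy ω).play E m).load) A.law}

/-- The cost `𝔼 [α * max f - f(A(E))]` incurred by `A` in `m` rounds against the adaptive request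
sequence `E`, where the maximum is the hindsight optimum on the realized requests. -/
def adaptiveCost {n : ℕ} (α : ℝ) (f : (Fin n → ℝ) → ℝ) (A : RandomizedPolicy.{u} n) (m : ℕ)
    (E : AdaptiveSeq n) : ℝ :=
  ∫ ω, (α * optValue f ((A.policy ω).play E m).requests - f ((A.policy ω).play E m).load) ∂A.law

/-- The worst-case `α`-regret of `A` against adaptive adversaries. -/
def adaptiveRegret {n : ℕ} (α : ℝ) (f : (Fin n → ℝ) → ℝ) (A : RandomizedPolicy.{u} n) : EReal :=
  ⨆ (m : ℕ) (q : ℝ) (_ : 0 < q) (E ∈ adaptiveSeqs f A m q), (adaptiveCost α f A m E : EReal)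

/-- The competitive ratio of `A` for maximizing `f` against adaptive adversaries. -/
def adaptiveCompetitiveRatio {n : ℕ} (f : (Fin n → ℝ) → ℝ) (A : RandomizedPolicy.{u} n) : ℝ≥0∞ :=
  ⨆ (α : ℝ≥0) (_ : 0 < α) (_ : adaptiveRegret α f A ≤ 0), (α : ℝ≥0∞)

/-! ### The objective -/

/-- Nash social welfare, the geometric mean of the loads. -/
def nsw (n : ℕ) (l : Fin n → ℝ) : ℝ := (∏ i, l i) ^ (1 / (n : ℝ))

end OnlineAllocation

end

namespace OnlineAllocation

/-! Lower bound for water-filling. Fix a level `θ` and a set `S` of offline nodes whose final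
water-filling load is at most `θ`. A request adjacent to `S` is placed by water-filling entirely at
levels up to `θ`, since no raised node ends above any neighbor. So any hindsight load puts on `S` at
most the quantity that water-filling holds below `θ` (`sum_le_sum_min_waterFilling`). These
level-set inequalities alone give `∏ l ≤ n! * ∏ w` (`prod_le_factorial_mul_prod`). The bound holds
on every request list, so it survives adaptivity.

Upper bound for all policies. Neighborhoods shrink by one offline node per round, in a uniformly
random order, and quantities grow by a factor `M + 1`. The surviving nodes look alike to the policy,
so the `j`-th node of `n`, counted from zero, gets on average about `(M + 1) ^ j / (n - j)`, while
hindsight gives it `(M + 1) ^ j`. AM-GM turns these averages into a bound on the mean Nash welfare,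
with ratio tending to `(1 / n!) ^ (1 / n)` as `M → ∞`. Averaging over orders as well as coin flips
covers randomized policies. An adaptive adversary may ignore what it observes, so the bound holds
there too. -/

/-! ### From level-set inequalities to a product inequality -/

/-- If the loads `l` satisfy the level-set inequalities of water-filling relative to `w`, then the
product of `l` is at most `card!` times the product of `w`. -/
theorem prod_le_factorial_mul_prod {ι : Type*} [DecidableEq ι] (s : Finset ι) (w : ι → ℝ)
    (hw : ∀ i ∈ s, 0 ≤ w i) :
    ∀ l : ι → ℝ, (∀ i ∈ s, 0 ≤ l i) →
      (∀ k ∈ s, ∑ i ∈ s with w i ≤ w k, l i ≤ ∑ i ∈ s, min (w i) (w k)) →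
      ∏ i ∈ s, l i ≤ (s.card ! : ℝ) * ∏ i ∈ s, w i := by
  induction s using Finset.induction_on_min_value w with
  | empty => intro l _ _; simp
  | insert a s ha hmin ih =>
    intro l hl h
    have hws : ∀ i ∈ s, 0 ≤ w i := fun i hi => hw i (Finset.mem_insert_of_mem hi)
    have hls : ∀ i ∈ s, 0 ≤ l i := fun i hi => hl i (Finset.mem_insert_of_mem hi)
    have hwa := hw a (Finset.mem_insert_self a s)
    have hla := hl a (Finset.mem_insert_self a s)
    have hpw : 0 ≤ ∏ i ∈ s, w i := Finset.prod_nonneg hws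
    have hfa : (0 : ℝ) < (s.card ! : ℝ) := by positivity
    have hA : l a ≤ (s.card + 1) * w a := by
      have h1 := h a (Finset.mem_insert_self a s)
      have h2 : l a ≤ ∑ i ∈ insert a s with w i ≤ w a, l i :=
        Finset.single_le_sum (f := l) (fun i hi => hl i (Finset.mem_filter.1 hi).1) (by simp)
      have h3 : ∑ i ∈ insert a s, min (w i) (w a) ≤ ∑ _i ∈ insert a s, w a :=
        Finset.sum_le_sum fun i _ => min_le_right _ _
      rw [Finset.sum_const, Finset.card_insert_of_notMem ha, nsmul_eq_mul] at h3
      push_cast at h3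
      linarith
    have hB : ∀ k ∈ s, ∑ i ∈ s with w i ≤ w k, l i + l a
        ≤ ∑ i ∈ s, min (w i) (w k) + w a := by
      intro k hk
      have h1 := h k (Finset.mem_insert_of_mem hk)
      rw [Finset.filter_insert, if_pos (hmin k hk), Finset.sum_insert (by simp [ha]),
        Finset.sum_insert ha, min_eq_left (hmin k hk)] at h1
      linarith
    rw [Finset.prod_insert ha, Finset.prod_insert ha, Finset.card_insert_of_notMem ha,
      Nat.factorial_succ]
    push_cast
    rcases le_or_gt (w a) (l a) with hc | hc
    -- The surplus of `a` only helps: the constraints on `s` hold for `l` unchanged, and `hA` pays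
    -- for the new factor of the factorial.
    · have := ih hws l hls fun k hk => by linarith [hB k hk]
      calc l a * ∏ i ∈ s, l i
          ≤ ((s.card + 1) * w a) * ((s.card ! : ℝ) * ∏ i ∈ s, w i) :=
            mul_le_mul hA this (Finset.prod_nonneg hls) (by positivity)
        _ = _ := by ring
    · have hwa' : 0 < w a := hla.trans_lt hc
      rcases s.eq_empty_or_nonempty with rfl | hne
      · simpa using hc.le
      have hcard : (0 : ℝ) < s.card := by exact_mod_cast hne.card_pos
      -- The constraints on `s` may now fail by up to `w a - l a`. As `w a` is the minimum, each
      -- right-hand side is at least `s.card * w a`, so dividing `l` by this `c` restores them all.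
      set c : ℝ := 1 + (1 - l a / w a) / s.card with hc_def
      have hsle : l a / w a < 1 := (div_lt_one hwa').2 hc
      have hcpos : 0 < c := by
        have : 0 < (1 - l a / w a) / s.card := div_pos (by linarith) hcard
        linarith
      have hIH := ih hws (fun i => l i / c) (fun i hi => div_nonneg (hls i hi) hcpos.le)
        fun k hk => by
          rw [← Finset.sum_div, div_le_iff₀ hcpos]
          have h1 : s.card * w a ≤ ∑ i ∈ s, min (w i) (w k) := by
            rw [← nsmul_eq_mul, ← Finset.sum_const]
            exact Finset.sum_le_sum fun i hi => le_min (hmin i hi) (hmin k hk)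
          have h2 : w a - l a = (s.card * w a) * ((1 - l a / w a) / s.card) := by
            field_simp
          have h3 : (s.card * w a) * ((1 - l a / w a) / s.card) ≤
              (∑ i ∈ s, min (w i) (w k)) * ((1 - l a / w a) / s.card) :=
            mul_le_mul_of_nonneg_right h1 (div_nonneg (by linarith) hcard.le)
          have h4 := hB k hk
          rw [hc_def, mul_add, mul_one]
          linarith
      rw [Finset.prod_div_distrib, Finset.prod_const, div_le_iff₀ (by positivity)] at hIH
      -- With `u = l a / w a`, the rescaling costs `c ^ s.card ≤ exp (1 - u)`, and `u * exp (1 - u)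
      -- ≤ 1`: the smallness of `l a` pays for it in full.
      have hexp : l a * c ^ s.card ≤ w a := by
        have h1 : c ^ s.card ≤ Real.exp (1 - l a / w a) := by
          calc c ^ s.card ≤ Real.exp ((1 - l a / w a) / s.card) ^ s.card := by
                gcongr
                rw [hc_def, add_comm]
                exact Real.add_one_le_exp _
            _ = Real.exp (1 - l a / w a) := by
                rw [← Real.exp_nat_mul]
                congr 1
                field_simp
        have h2 : l a / w a ≤ Real.exp (l a / w a - 1) := by
          have := Real.add_one_le_exp (l a / w a - 1)
          linarith
        have h3 : l a ≤ w a * Real.exp (l a / w a - 1) := by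
          rwa [div_le_iff₀ hwa', mul_comm] at h2
        calc l a * c ^ s.card
            ≤ (w a * Real.exp (l a / w a - 1)) * Real.exp (1 - l a / w a) := by gcongr
          _ = w a := by rw [mul_assoc, ← Real.exp_add]; simp
      calc l a * ∏ i ∈ s, l i
          ≤ l a * ((s.card ! : ℝ) * (∏ i ∈ s, w i) * c ^ s.card) := by gcongr
        _ = (l a * c ^ s.card) * ((s.card ! : ℝ) * ∏ i ∈ s, w i) := by ring
        _ ≤ w a * ((s.card ! : ℝ) * ∏ i ∈ s, w i) := by gcongr
        _ ≤ (s.card + 1) * (w a * ((s.card ! : ℝ) * ∏ i ∈ s, w i)) :=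
            le_mul_of_one_le_left (by positivity) (by linarith)
        _ = _ := by ring

/-! ### Runs of policies -/

variable {n : ℕ}

theorem Policy.run_append_singleton (A : Policy n) (E : List (Request n)) (r : Request n) :
    A.run (E ++ [r]) = A.run E ++ [(r, A.alloc (A.run E) r)] := by
  simp [Policy.run]

theorem Policy.load_nil (A : Policy n) : A.load [] = 0 := by
  simp [Policy.load, Policy.run, History.load]

theorem Policy.load_append_singleton (A : Policy n) (E : List (Request n)) (r : Request n) :
    A.load (E ++ [r]) = A.load E + A.alloc (A.run E) r := by
  simp [Policy.load, A.run_append_singleton, History.load]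

theorem Policy.length_run (A : Policy n) (E : List (Request n)) :
    (A.run E).length = E.length := by
  induction E using List.reverseRecOn with
  | nil => simp [Policy.run]
  | append_singleton E r ih => simp [A.run_append_singleton, ih]

theorem Policy.requests_run (A : Policy n) (E : List (Request n)) :
    (A.run E).requests = E := by
  induction E using List.reverseRecOn with
  | nil => simp [Policy.run, History.requests]
  | append_singleton E r ih =>
    simp only [History.requests] at ih
    simp [A.run_append_singleton, History.requests, ih]

/-- A deterministic policy reacts to adaptive play exactly as to the realized list fixed in advance,
so pointwise bounds on request lists transfer to adaptive adversaries. -/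
theorem Policy.run_requests_play (A : Policy n) (E : AdaptiveSeq n) (m : ℕ) :
    A.run (A.play E m).requests = A.play E m := by
  induction m with
  | zero => simp [Policy.play, Policy.run, History.requests]
  | succ m ih =>
    have : (A.play E (m + 1)).requests = (A.play E m).requests ++ [E (A.play E m)] := by
      simp [Policy.play, History.requests]
    rw [this, A.run_append_singleton, ih]
    rfl

/-- Conversely, a fixed sequence is an adaptive one that looks only at the round number. -/
theorem Policy.play_length (A : Policy n) (r : ℕ → Request n) (m : ℕ) :
    A.play (fun h => r h.length) m = A.run ((List.range m).map r) := by
  induction m with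
  | zero => simp [Policy.play, Policy.run]
  | succ m ih =>
    rw [Policy.play, ih, List.range_succ, List.map_append, List.map_singleton,
      A.run_append_singleton, A.length_run]
    simp

theorem Policy.load_nonneg (A : Policy n) (E : List (Request n)) (i : Fin n) :
    0 ≤ A.load E i := by
  induction E using List.reverseRecOn with
  | nil => simp [A.load_nil]
  | append_singleton E r ih =>
    rw [A.load_append_singleton]
    exact add_nonneg ih ((A.feasible _ r).1 i)

theorem Policy.load_range (A : Policy n) (r : ℕ → Request n) (m : ℕ) :
    A.load ((List.range m).map r) =
      ∑ t ∈ Finset.range m, A.alloc (A.run ((List.range t).map r)) (r t) := by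
  induction m with
  | zero => simp [A.load_nil]
  | succ m ih =>
    rw [List.range_succ, List.map_append, List.map_singleton, A.load_append_singleton, ih,
      Finset.sum_range_succ]

/-! ### Feasible loads -/

theorem feasibleLoads_nil : feasibleLoads ([] : List (Request n)) = {0} := by
  rw [Set.singleton_zero]
  simp [feasibleLoads]

theorem feasibleLoads_append_singleton (E : List (Request n)) (r : Request n) :
    feasibleLoads (E ++ [r]) = feasibleLoads E + r.allocations := by
  simp [feasibleLoads]

theorem Policy.load_mem_feasibleLoads (A : Policy n) (E : List (Request n)) :
    A.load E ∈ feasibleLoads E := by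
  induction E using List.reverseRecOn with
  | nil => simp [A.load_nil, feasibleLoads_nil]
  | append_singleton E r ih =>
    rw [A.load_append_singleton, feasibleLoads_append_singleton]
    exact Set.add_mem_add ih (A.feasible _ r)

theorem sum_range_mem_feasibleLoads (r : ℕ → Request n) (y : ℕ → Fin n → ℝ) (m : ℕ)
    (hy : ∀ t < m, y t ∈ (r t).allocations) :
    ∑ t ∈ Finset.range m, y t ∈ feasibleLoads ((List.range m).map r) := by
  induction m with
  | zero => simp [feasibleLoads_nil]
  | succ m ih =>
    rw [List.range_succ, List.map_append, List.map_singleton, feasibleLoads_append_singleton,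
      Finset.sum_range_succ]
    exact Set.add_mem_add (ih fun t ht => hy t (by omega)) (hy m (by omega))

theorem feasibleLoads_nonneg {E : List (Request n)} {l : Fin n → ℝ} (hl : l ∈ feasibleLoads E)
    (i : Fin n) : 0 ≤ l i := by
  induction E using List.reverseRecOn generalizing l with
  | nil =>
    rw [feasibleLoads_nil, Set.mem_singleton_iff] at hl
    simp [hl]
  | append_singleton E r ih =>
    rw [feasibleLoads_append_singleton] at hl
    obtain ⟨l', hl', y, hy, rfl⟩ := hl
    exact add_nonneg (ih hl') (hy.1 i)

/-! ### Water-filling -/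

/-- An allocation maximizing the minimum neighboring load only raises neighbors to that minimum. -/
theorem level_le_of_isMaxOn {r : Request n} {l x : Fin n → ℝ} (hx : x ∈ r.allocations)
    (hmax : IsMaxOn (minNbrLoad r l) r.allocations x) {j : Fin n} (hj : 0 < x j) {i : Fin n}
    (hi : i ∈ r.nbrs) : x j + l j ≤ x i + l i := by
  by_contra! hlt
  set μ := minNbrLoad r l x with hμ
  have hμi : μ ≤ x i + l i := Finset.inf'_le (fun i => x i + l i) hi
  have hjN : j ∈ r.nbrs := by
    by_contra hjN
    exact hj.ne' (hx.2.1 j hjN)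
  have hN : (0 : ℝ) < r.nbrs.card := by exact_mod_cast r.nbrs_nonempty.card_pos
  -- Exchange argument: take `δ` from `j` and spread it evenly over all neighbors. The bound by `x
  -- j` keeps the allocation nonnegative, and the strict bound keeps `j` above `μ`, so the minimum
  -- would strictly increase.
  obtain ⟨δ, hδ0, hδx, hδμ⟩ : ∃ δ : ℝ, 0 < δ ∧ δ ≤ x j ∧ δ < x j + l j - μ := by
    refine ⟨min (x j) ((x j + l j - μ) / 2), lt_min hj (by linarith), min_le_left _ _, ?_⟩
    exact (min_le_right _ _).trans_lt (by linarith)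
  set ε := δ / r.nbrs.card with hε
  have hε0 : 0 < ε := div_pos hδ0 hN
  set y : Fin n → ℝ := fun k =>
    x k + (if k ∈ r.nbrs then ε else 0) - (if k = j then δ else 0) with hy
  have hyA : y ∈ r.allocations := by
    refine ⟨fun k => ?_, fun k hk => ?_, ?_⟩
    · have h0 := hx.1 k
      have h1 : (0 : ℝ) ≤ if k ∈ r.nbrs then ε else 0 := by split_ifs <;> positivity
      simp only [hy]
      by_cases hkj : k = j
      · subst hkj; simp only [if_true]; linarith
      · simp only [hkj, if_false]; linarith
    · have hkj : k ≠ j := fun h => hk (h ▸ hjN)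
      simp [hy, hk, hkj, hx.2.1 k hk]
    · simp only [hy, Finset.sum_sub_distrib, Finset.sum_add_distrib, Finset.sum_ite_mem,
        Finset.univ_inter, Finset.sum_const, nsmul_eq_mul, Finset.sum_ite_eq', Finset.mem_univ,
        if_true, hx.2.2, hε]
      field_simp
      ring
  have hle : minNbrLoad r l y ≤ μ := hmax hyA
  have hgt : μ < minNbrLoad r l y := by
    rw [minNbrLoad, Finset.lt_inf'_iff]
    intro k hk
    have hk' : μ ≤ x k + l k := Finset.inf'_le (fun i => x i + l i) hk
    simp only [hy, if_pos hk]
    by_cases hkj : k = j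
    · subst hkj; simp only [if_true]; linarith
    · simp only [hkj, if_false]; linarith
  linarith

theorem waterFilling_level_le (h : History n) (r : Request n) {i j : Fin n}
    (hj : 0 < (waterFilling n).alloc h r j) (hi : i ∈ r.nbrs) :
    (waterFilling n).alloc h r j + h.load j ≤ (waterFilling n).alloc h r i + h.load i :=
  level_le_of_isMaxOn (exists_isMaxOn_minNbrLoad r h.load).choose_spec.1
    (exists_isMaxOn_minNbrLoad r h.load).choose_spec.2 hj hi

/-- The hindsight load of a set of offline nodes which water-filling leaves below level `θ` is at
most the quantity that water-filling places below that level. -/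
theorem sum_le_sum_min_waterFilling {E : List (Request n)} {l : Fin n → ℝ}
    (hl : l ∈ feasibleLoads E) (S : Finset (Fin n)) {θ : ℝ} (hθ : 0 ≤ θ)
    (hS : ∀ i ∈ S, (waterFilling n).load E i ≤ θ) :
    ∑ i ∈ S, l i ≤ ∑ j, min ((waterFilling n).load E j) θ := by
  induction E using List.reverseRecOn generalizing l with
  | nil =>
    rw [feasibleLoads_nil, Set.mem_singleton_iff] at hl
    simp [hl, Policy.load_nil, hθ]
  | append_singleton E r ih =>
    rw [feasibleLoads_append_singleton] at hl
    obtain ⟨l', hl', y, hy, rfl⟩ := hl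
    set x := (waterFilling n).alloc ((waterFilling n).run E) r with hx
    have hxA : x ∈ r.allocations := (waterFilling n).feasible _ r
    rw [Policy.load_append_singleton, ← hx] at hS ⊢
    simp only [Pi.add_apply, Finset.sum_add_distrib] at hS ⊢
    have h1 := ih hl' fun i hi => by linarith [hS i hi, hxA.1 i]
    by_cases hne : ∃ i ∈ S, i ∈ r.nbrs
    · obtain ⟨i, hiS, hiN⟩ := hne
      have h2 : ∑ i ∈ S, y i ≤ r.qty := hy.2.2 ▸
        Finset.sum_le_sum_of_subset_of_nonneg (Finset.subset_univ S) fun i _ _ => hy.1 i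
      -- A node that receives anything ends no higher than the neighbor `i ∈ S`, hence at most at
      -- `θ`. Truncation therefore loses nothing of `x`, and the right-hand side grows by the whole
      -- `r.qty`.
      have h3 : ∀ j, min ((waterFilling n).load E j) θ + x j ≤
          min ((waterFilling n).load E j + x j) θ := by
        intro j
        rcases (hxA.1 j).eq_or_lt with h0 | h0
        · simp [← h0]
        · have h4 := waterFilling_level_le ((waterFilling n).run E) r h0 hiN
          have h5 := hS i hiS
          change x j + (waterFilling n).load E j ≤ x i + (waterFilling n).load E i at h4
          rw [min_eq_left (show (waterFilling n).load E j + x j ≤ θ by linarith)]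
          exact add_le_add_left (min_le_left _ _) _
      have h6 := Finset.sum_le_sum fun j (_ : j ∈ Finset.univ) => h3 j
      rw [Finset.sum_add_distrib, hxA.2.2] at h6
      linarith
    · push Not at hne
      have h2 : ∑ i ∈ S, y i = 0 := Finset.sum_eq_zero fun i hi => hy.2.1 i (hne i hi)
      have h3 : ∑ j, min ((waterFilling n).load E j) θ ≤
          ∑ j, min ((waterFilling n).load E j + x j) θ :=
        Finset.sum_le_sum fun j _ => min_le_min_right _ (by linarith [hxA.1 j])
      linarith

theorem prod_le_factorial_mul_prod_waterFilling {E : List (Request n)} {l : Fin n → ℝ}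
    (hl : l ∈ feasibleLoads E) :
    ∏ i, l i ≤ (n ! : ℝ) * ∏ i, (waterFilling n).load E i := by
  have := prod_le_factorial_mul_prod Finset.univ ((waterFilling n).load E)
    (fun i _ => Policy.load_nonneg _ E i) l (fun i _ => feasibleLoads_nonneg hl i)
    fun k _ => sum_le_sum_min_waterFilling hl _ (Policy.load_nonneg _ E k) (by simp)
  simpa using this

theorem nsw_le_waterFilling {E : List (Request n)} {l : Fin n → ℝ} (hl : l ∈ feasibleLoads E) :
    (1 / (n ! : ℝ)) ^ (1 / (n : ℝ)) * nsw n l ≤ nsw n ((waterFilling n).load E) := by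
  have h0 : 0 ≤ ∏ i, l i := Finset.prod_nonneg fun i _ => feasibleLoads_nonneg hl i
  rw [nsw, nsw, ← Real.mul_rpow (by positivity) h0]
  refine Real.rpow_le_rpow (by positivity) ?_ (by positivity)
  rw [one_div, inv_mul_le_iff₀ (by positivity)]
  exact prod_le_factorial_mul_prod_waterFilling hl

/-- Needed because `sSup` of an unbounded real set is `0`. The water-filling bound already supplies
an upper bound, without compactness. -/
theorem bddAbove_nsw_feasibleLoads (E : List (Request n)) :
    BddAbove (nsw n '' feasibleLoads E) := by
  refine ⟨((1 / (n ! : ℝ)) ^ (1 / (n : ℝ)))⁻¹ * nsw n ((waterFilling n).load E), ?_⟩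
  rintro _ ⟨l, hl, rfl⟩
  rw [le_inv_mul_iff₀ (by positivity)]
  exact nsw_le_waterFilling hl

theorem optValue_nsw_le_waterFilling (E : List (Request n)) :
    (1 / (n ! : ℝ)) ^ (1 / (n : ℝ)) * optValue (nsw n) E ≤ nsw n ((waterFilling n).load E) := by
  rw [← le_inv_mul_iff₀ (by positivity)]
  refine csSup_le (Set.Nonempty.image _ ⟨_, (waterFilling n).load_mem_feasibleLoads E⟩) ?_
  rintro _ ⟨l, hl, rfl⟩
  rw [le_inv_mul_iff₀ (by positivity)]
  exact nsw_le_waterFilling hl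

/-! ### Competitive ratios -/

theorem Policy.cost_toRandomized (A : Policy n) (α : ℝ) (f : (Fin n → ℝ) → ℝ)
    (E : List (Request n)) :
    cost α f A.toRandomized E = α * optValue f E - f (A.load E) := by
  have : ∫ ω, f ((A.toRandomized.policy ω).load E) ∂A.toRandomized.law = f (A.load E) := by
    change ∫ _ : Unit, f (A.load E) ∂(Measure.dirac ()) = _
    simp
  rw [cost, this]

theorem Policy.adaptiveCost_toRandomized (A : Policy n) (α : ℝ) (f : (Fin n → ℝ) → ℝ) (m : ℕ)
    (E : AdaptiveSeq n) :
    adaptiveCost α f A.toRandomized m E =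
      α * optValue f (A.play E m).requests - f (A.load (A.play E m).requests) := by
  rw [Policy.load, A.run_requests_play]
  change ∫ _ : Unit, (α * optValue f (A.play E m).requests - f (A.play E m).load)
    ∂(Measure.dirac ()) = _
  simp

theorem le_competitiveRatio_of_regret {f : (Fin n → ℝ) → ℝ} {A : RandomizedPolicy.{u} n} {c : ℝ}
    (hc : 0 < c) (h : regret c f A ≤ 0) : ENNReal.ofReal c ≤ competitiveRatio f A := by
  have h1 : (c.toNNReal : ℝ) = c := Real.coe_toNNReal _ hc.le
  exact le_iSup_of_le c.toNNReal (le_iSup_of_le (by simpa using hc)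
    (le_iSup_of_le (by rwa [h1]) le_rfl))

theorem le_adaptiveCompetitiveRatio_of_regret {f : (Fin n → ℝ) → ℝ} {A : RandomizedPolicy.{u} n}
    {c : ℝ} (hc : 0 < c) (h : adaptiveRegret c f A ≤ 0) :
    ENNReal.ofReal c ≤ adaptiveCompetitiveRatio f A := by
  have h1 : (c.toNNReal : ℝ) = c := Real.coe_toNNReal _ hc.le
  exact le_iSup_of_le c.toNNReal (le_iSup_of_le (by simpa using hc)
    (le_iSup_of_le (by rwa [h1]) le_rfl))

theorem le_competitiveRatio_waterFilling :
    ENNReal.ofReal ((1 / (n ! : ℝ)) ^ (1 / (n : ℝ))) ≤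
      competitiveRatio (nsw n) (waterFilling n).toRandomized := by
  refine le_competitiveRatio_of_regret (by positivity) ?_
  refine iSup_le fun m => iSup_le fun q => iSup_le fun _ => iSup_le fun E => iSup_le fun _ => ?_
  rw [Policy.cost_toRandomized]
  exact_mod_cast sub_nonpos.2 (optValue_nsw_le_waterFilling E)

theorem le_adaptiveCompetitiveRatio_waterFilling :
    ENNReal.ofReal ((1 / (n ! : ℝ)) ^ (1 / (n : ℝ))) ≤
      adaptiveCompetitiveRatio (nsw n) (waterFilling n).toRandomized := by
  refine le_adaptiveCompetitiveRatio_of_regret (by positivity) ?_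
  refine iSup_le fun m => iSup_le fun q => iSup_le fun _ => iSup_le fun E => iSup_le fun _ => ?_
  rw [Policy.adaptiveCost_toRandomized]
  exact_mod_cast sub_nonpos.2 (optValue_nsw_le_waterFilling _)

/-! ### The hard instances: nested neighborhoods in random order, geometric quantities -/

/-- The `t`-th online node is adjacent to all offline nodes but the first `t` in the order `π`, and
has quantity `(M + 1) ^ t`. -/
noncomputable def nestedRequest {k : ℕ} (M : ℕ) (π : Equiv.Perm (Fin (k + 1))) (t : ℕ) :
    Request (k + 1) where
  -- The cap at `k` keeps the neighborhood non-empty for `t > k`; the hard instances use only `t ≤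
  -- k`.
  nbrs := {i | min t k ≤ (π.symm i : ℕ)}
  qty := ((M : ℝ) + 1) ^ t
  nbrs_nonempty := ⟨π (Fin.last k), by simp⟩
  qty_pos := by positivity

/-- The sequence of nested requests in the order `π`. -/
noncomputable def nestedSeq {k : ℕ} (M : ℕ) (π : Equiv.Perm (Fin (k + 1))) :
    List (Request (k + 1)) :=
  (List.range (k + 1)).map (nestedRequest M π)

/-- The allocation by `A` of the `t`-th node of the nested requests in the order `π`. -/
noncomputable def Policy.nestedAlloc {k : ℕ} (A : Policy (k + 1)) (M : ℕ)
    (π : Equiv.Perm (Fin (k + 1))) (t : ℕ) : Fin (k + 1) → ℝ :=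
  A.alloc (A.run ((List.range t).map (nestedRequest M π))) (nestedRequest M π t)

section Nested

variable {k : ℕ} (A : Policy (k + 1)) (M : ℕ)

/-- Request `s` depends on the order only through the set of nodes in positions at least `min s k`;
a swap of two such positions is invisible. -/
theorem nestedRequest_mul_swap (π : Equiv.Perm (Fin (k + 1))) {t s : ℕ} {i j : Fin (k + 1)}
    (hi : t ≤ i) (hj : t ≤ j) (hs : s ≤ t) :
    nestedRequest M (π * Equiv.swap i j) s = nestedRequest M π s := by
  unfold nestedRequest
  congr 1
  ext l
  have h1 : (π * Equiv.swap i j).symm l = Equiv.swap i j (π.symm l) := by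
    rw [Equiv.symm_apply_eq]
    simp
  simp only [Finset.mem_filter_univ, h1, Equiv.swap_apply_def]
  split_ifs with h2 h3
  · rw [h2]; omega
  · rw [h3]; omega
  · rfl

theorem Policy.nestedAlloc_mul_swap (π : Equiv.Perm (Fin (k + 1))) {t : ℕ} {i j : Fin (k + 1)}
    (hi : t ≤ i) (hj : t ≤ j) :
    A.nestedAlloc M (π * Equiv.swap i j) t = A.nestedAlloc M π t := by
  have h : (List.range t).map (nestedRequest M (π * Equiv.swap i j)) =
      (List.range t).map (nestedRequest M π) :=
    List.map_congr_left fun s hs =>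
      nestedRequest_mul_swap M π hi hj (List.mem_range.1 hs).le
  rw [nestedAlloc, nestedAlloc, h, nestedRequest_mul_swap M π hi hj le_rfl]

/-- Exchangeability: composing the order with the swap is a bijection of orders that the policy
cannot detect through round `t`. -/
theorem Policy.sum_perm_nestedAlloc_eq {t : ℕ} {i j : Fin (k + 1)} (hi : t ≤ i) (hj : t ≤ j) :
    ∑ π : Equiv.Perm (Fin (k + 1)), A.nestedAlloc M π t (π i) =
      ∑ π : Equiv.Perm (Fin (k + 1)), A.nestedAlloc M π t (π j) :=
  Fintype.sum_equiv (Equiv.mulRight (Equiv.swap i j)) _ _ fun π => by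
    simp [A.nestedAlloc_mul_swap M π hi hj]

theorem Policy.nestedAlloc_eq_zero (π : Equiv.Perm (Fin (k + 1))) {t : ℕ} (ht : t ≤ k)
    {j : Fin (k + 1)} (hj : (j : ℕ) < t) : A.nestedAlloc M π t (π j) = 0 := by
  refine (A.feasible _ (nestedRequest M π t)).2.1 _ ?_
  simp only [nestedRequest, Finset.mem_filter_univ, Equiv.symm_apply_apply]
  omega

/-- On average over the order, each of the remaining offline nodes gets the same share. -/
theorem Policy.card_mul_sum_perm_nestedAlloc {t j : Fin (k + 1)} (hj : t ≤ j) :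
    ((k + 1 - t : ℕ) : ℝ) * ∑ π : Equiv.Perm (Fin (k + 1)), A.nestedAlloc M π t (π j) =
      ((k + 1)! : ℝ) * ((M : ℝ) + 1) ^ (t : ℕ) := by
  have h1 : ∑ i, ∑ π : Equiv.Perm (Fin (k + 1)), A.nestedAlloc M π t (π i) =
      ((k + 1)! : ℝ) * ((M : ℝ) + 1) ^ (t : ℕ) := by
    rw [Finset.sum_comm]
    have h2 : ∀ π : Equiv.Perm (Fin (k + 1)), ∑ i, A.nestedAlloc M π t (π i) =
        ((M : ℝ) + 1) ^ (t : ℕ) := fun π => by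
      rw [Equiv.sum_comp π]
      exact (A.feasible _ (nestedRequest M π t)).2.2
    simp only [h2, Finset.sum_const, Finset.card_univ, Fintype.card_perm, Fintype.card_fin,
      nsmul_eq_mul]
  rw [← h1, ← Fin.card_Ici, ← nsmul_eq_mul, ← Finset.sum_const]
  rw [← Finset.sum_subset (Finset.subset_univ (Finset.Ici t))]
  · exact Finset.sum_congr rfl fun i hi =>
      A.sum_perm_nestedAlloc_eq M (Fin.le_def.1 hj) (Fin.le_def.1 (Finset.mem_Ici.1 hi))
  · intro i _ hi
    refine Finset.sum_eq_zero fun π _ => A.nestedAlloc_eq_zero M π (by omega) ?_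
    simpa using hi

/-- The leading term of the average load of the `j`-th offline node. -/
noncomputable def nestedShare (k M : ℕ) (j : Fin (k + 1)) : ℝ :=
  ((M : ℝ) + 1) ^ (j : ℕ) / ((k + 1 - j : ℕ) : ℝ)

theorem nestedShare_pos (j : Fin (k + 1)) : 0 < nestedShare k M j := by
  have : (0 : ℝ) < ((k + 1 - j : ℕ) : ℝ) := by exact_mod_cast (by omega)
  unfold nestedShare
  positivity

/-- Round `j` yields exactly the leading term. Earlier rounds have quantities smaller by a factor of
at least `M + 1` and more neighbors to share them; later rounds no longer reach the node. -/
theorem Policy.sum_perm_nestedAlloc_le (t j : Fin (k + 1)) :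
    ∑ π : Equiv.Perm (Fin (k + 1)), A.nestedAlloc M π t (π j) ≤
      (if t = j then ((k + 1)! : ℝ) * nestedShare k M j else 0) +
        ((k + 1)! : ℝ) * nestedShare k M j / ((M : ℝ) + 1) := by
  have hs := nestedShare_pos M j
  have hpos : (0 : ℝ) < ((k + 1 - t : ℕ) : ℝ) := by exact_mod_cast (by omega)
  have hposj : (0 : ℝ) < ((k + 1 - j : ℕ) : ℝ) := by exact_mod_cast (by omega)
  rcases lt_trichotomy t j with h | rfl | h
  · rw [if_neg h.ne, zero_add]
    have h1 := A.card_mul_sum_perm_nestedAlloc M h.le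
    rw [mul_comm, ← eq_div_iff hpos.ne'] at h1
    rw [h1, mul_div_assoc, mul_div_assoc]
    refine mul_le_mul_of_nonneg_left ?_ (by positivity)
    rw [nestedShare, div_right_comm]
    have h2 : ((M : ℝ) + 1) ^ (t : ℕ) ≤ ((M : ℝ) + 1) ^ (j : ℕ) / ((M : ℝ) + 1) := by
      rw [le_div_iff₀ (by positivity), ← pow_succ]
      exact pow_le_pow_right₀ (by simp) h
    have h3 : ((k + 1 - j : ℕ) : ℝ) ≤ ((k + 1 - t : ℕ) : ℝ) := by
      exact_mod_cast (by have : (t : ℕ) < j := h; omega)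
    exact div_le_div₀ (by positivity) h2 hposj h3
  · have h1 := A.card_mul_sum_perm_nestedAlloc M (le_refl t)
    rw [mul_comm, ← eq_div_iff hpos.ne', mul_div_assoc] at h1
    rw [h1, if_pos rfl]
    exact le_add_of_nonneg_right (by positivity)
  · rw [Finset.sum_eq_zero fun π _ => A.nestedAlloc_eq_zero M π (by omega) h, if_neg h.ne']
    positivity

theorem Policy.load_nestedSeq (π : Equiv.Perm (Fin (k + 1))) (i : Fin (k + 1)) :
    A.load (nestedSeq M π) i = ∑ t : Fin (k + 1), A.nestedAlloc M π t i := by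
  rw [nestedSeq, A.load_range, Finset.sum_apply,
    Fin.sum_univ_eq_sum_range (fun t => A.nestedAlloc M π t i)]
  rfl

theorem Policy.sum_perm_load_nestedSeq_le (j : Fin (k + 1)) :
    ∑ π : Equiv.Perm (Fin (k + 1)), A.load (nestedSeq M π) (π j) ≤
      ((k + 1)! : ℝ) * nestedShare k M j * (1 + ((k : ℝ) + 1) / ((M : ℝ) + 1)) := by
  simp only [A.load_nestedSeq]
  rw [Finset.sum_comm]
  refine (Finset.sum_le_sum fun t _ => A.sum_perm_nestedAlloc_le M t j).trans_eq ?_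
  rw [Finset.sum_add_distrib, Finset.sum_ite_eq']
  simp
  ring

/-- The source of the factorial: the numbers of surviving nodes, `k + 1` down to `1`, multiply to
it. -/
theorem prod_nestedShare :
    ∏ j, nestedShare k M j = (1 / ((k + 1)! : ℝ)) * ∏ j : Fin (k + 1), ((M : ℝ) + 1) ^ (j : ℕ) := by
  have h : ∏ j : Fin (k + 1), ((k + 1 - j : ℕ) : ℝ) = ((k + 1)! : ℝ) := by
    rw [Fin.prod_univ_eq_prod_range (fun j => ((k + 1 - j : ℕ) : ℝ)),
      ← Finset.prod_range_reflect, ← Finset.prod_range_add_one_eq_factorial]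
    push_cast
    refine Finset.prod_congr rfl fun j hj => ?_
    have := Finset.mem_range.1 hj
    exact_mod_cast (by omega : k + 1 - (k - j) = j + 1)
  simp only [nestedShare]
  rw [Finset.prod_div_distrib, h]
  ring

/-- The optimal Nash social welfare of the nested requests, up to a factor. -/
noncomputable def nestedOpt (k M : ℕ) : ℝ :=
  (∏ j : Fin (k + 1), ((M : ℝ) + 1) ^ (j : ℕ)) ^ (1 / ((k + 1 : ℕ) : ℝ))

theorem nestedOpt_pos : 0 < nestedOpt k M := by
  unfold nestedOpt
  positivity

theorem nestedOpt_le_optValue (π : Equiv.Perm (Fin (k + 1))) :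
    nestedOpt k M ≤ optValue (nsw (k + 1)) (nestedSeq M π) := by
  -- In hindsight, each request goes entirely to the neighbor that is about to drop out.
  set y : ℕ → Fin (k + 1) → ℝ := fun t i =>
    if (π.symm i : ℕ) = t then ((M : ℝ) + 1) ^ t else 0 with hy
  have hmem : ∑ t ∈ Finset.range (k + 1), y t ∈ feasibleLoads (nestedSeq M π) := by
    refine sum_range_mem_feasibleLoads _ _ _ fun t ht => ⟨fun i => ?_, fun i hi => ?_, ?_⟩
    · simp only [hy]; split_ifs <;> positivity
    · simp only [nestedRequest, Finset.mem_filter_univ] at hi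
      simp only [hy]
      rw [if_neg (by omega)]
    · rw [← Equiv.sum_comp π]
      simp only [hy, Equiv.symm_apply_apply, nestedRequest]
      rw [Fin.sum_univ_eq_sum_range (fun j => if j = t then ((M : ℝ) + 1) ^ t else 0),
        Finset.sum_ite_eq', if_pos (Finset.mem_range.2 ht)]
  refine le_csSup_of_le (bddAbove_nsw_feasibleLoads _) ⟨_, hmem, rfl⟩ (le_of_eq ?_)
  rw [nestedOpt, nsw]
  congr 1
  refine (Finset.prod_congr rfl fun j _ => ?_).trans (Equiv.prod_comp π _)
  simp [hy, Nat.lt_succ_iff.1 j.2]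

/-- AM-GM for the ratios `l i / c i`, with equality when `l` is proportional to `c`. The right-hand
side is linear in `l`, so only average loads matter. -/
theorem nsw_le_mul_sum {l c : Fin (k + 1) → ℝ} (hl : ∀ i, 0 ≤ l i) (hc : ∀ i, 0 < c i) :
    nsw (k + 1) l ≤ (∏ i, c i) ^ (1 / ((k + 1 : ℕ) : ℝ)) *
      ∑ i, 1 / ((k + 1 : ℕ) : ℝ) * (l i / c i) := by
  have h1 := Real.geom_mean_le_arith_mean_weighted Finset.univ
    (fun _ : Fin (k + 1) => 1 / ((k + 1 : ℕ) : ℝ)) (fun i => l i / c i)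
    (fun _ _ => by positivity) (by simp; field_simp)
    (fun i _ => div_nonneg (hl i) (hc i).le)
  rw [Real.finsetProd_rpow _ _ fun i _ => div_nonneg (hl i) (hc i).le] at h1
  refine le_trans (le_of_eq ?_)
    (mul_le_mul_of_nonneg_left h1 (Real.rpow_nonneg (Finset.prod_nonneg fun i _ => (hc i).le) _))
  rw [← Real.mul_rpow (Finset.prod_nonneg fun i _ => (hc i).le)
    (Finset.prod_nonneg fun i _ => div_nonneg (hl i) (hc i).le), ← Finset.prod_mul_distrib, nsw]
  congr 1
  exact Finset.prod_congr rfl fun i _ => (mul_div_cancel₀ _ (hc i).ne').symm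

theorem nsw_comp_perm (π : Equiv.Perm (Fin (k + 1))) (l : Fin (k + 1) → ℝ) :
    nsw (k + 1) (fun j => l (π j)) = nsw (k + 1) l := by
  rw [nsw, nsw, Equiv.prod_comp π]

/-- Every policy is far from optimal on average over the orders of the nested requests. -/
theorem Policy.sum_perm_nsw_nestedSeq_le :
    ∑ π : Equiv.Perm (Fin (k + 1)), nsw (k + 1) (A.load (nestedSeq M π)) ≤
      ((k + 1)! : ℝ) * ((1 / ((k + 1)! : ℝ)) ^ (1 / ((k + 1 : ℕ) : ℝ)) * nestedOpt k M *
        (1 + ((k : ℝ) + 1) / ((M : ℝ) + 1))) := by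
  have h1 : (1 / ((k + 1)! : ℝ)) ^ (1 / ((k + 1 : ℕ) : ℝ)) * nestedOpt k M =
      (∏ j, nestedShare k M j) ^ (1 / ((k + 1 : ℕ) : ℝ)) := by
    rw [prod_nestedShare, nestedOpt, ← Real.mul_rpow (by positivity) (by positivity)]
  have hC : 0 ≤ (∏ j, nestedShare k M j) ^ (1 / ((k + 1 : ℕ) : ℝ)) :=
    Real.rpow_nonneg (Finset.prod_nonneg fun j _ => (nestedShare_pos M j).le) _
  rw [h1]
  set C := (∏ j, nestedShare k M j) ^ (1 / ((k + 1 : ℕ) : ℝ)) with hCdef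
  calc ∑ π : Equiv.Perm (Fin (k + 1)), nsw (k + 1) (A.load (nestedSeq M π))
      ≤ ∑ π : Equiv.Perm (Fin (k + 1)), C * ∑ j, 1 / ((k + 1 : ℕ) : ℝ) *
          (A.load (nestedSeq M π) (π j) / nestedShare k M j) :=
        Finset.sum_le_sum fun π _ => by
          rw [← nsw_comp_perm π]
          exact nsw_le_mul_sum (fun j => A.load_nonneg _ _) (nestedShare_pos M)
    _ = C * ∑ j, 1 / ((k + 1 : ℕ) : ℝ) *
          ((∑ π : Equiv.Perm (Fin (k + 1)), A.load (nestedSeq M π) (π j)) / nestedShare k M j) := by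
        rw [← Finset.mul_sum, Finset.sum_comm]
        simp only [Finset.sum_div, Finset.mul_sum]
    _ ≤ C * ∑ _j : Fin (k + 1), 1 / ((k + 1 : ℕ) : ℝ) *
          (((k + 1)! : ℝ) * (1 + ((k : ℝ) + 1) / ((M : ℝ) + 1))) := by
        gcongr with j
        rw [div_le_iff₀ (nestedShare_pos M j)]
        refine (A.sum_perm_load_nestedSeq_le M j).trans_eq ?_
        ring
    _ = _ := by
        rw [Finset.sum_const, Finset.card_univ, Fintype.card_fin, nsmul_eq_mul]
        field_simp

end Nested

/-! ### Upper bounds on the competitive ratios -/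

theorem measurable_nsw (n : ℕ) : Measurable (nsw n) := by
  unfold nsw
  fun_prop

theorem RandomizedPolicy.integrable_nsw_load {n : ℕ} (A : RandomizedPolicy.{u} n)
    (E : List (Request n)) : Integrable (fun ω => nsw n ((A.policy ω).load E)) A.law := by
  refine Integrable.of_bound ((measurable_nsw n).comp (A.measurable_load E)).aestronglyMeasurable
    (optValue (nsw n) E) (Eventually.of_forall fun ω => ?_)
  rw [Real.norm_of_nonneg (r := nsw n _)
    (Real.rpow_nonneg (Finset.prod_nonneg fun i _ => (A.policy ω).load_nonneg E i) _)]
  exact le_csSup (bddAbove_nsw_feasibleLoads E) ⟨_, (A.policy ω).load_mem_feasibleLoads E, rfl⟩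

/-- No constant above `(1 / n!) ^ (1 / n)` is guaranteed on all nested request sequences. -/
theorem le_of_forall_nestedSeq {k : ℕ} (A : RandomizedPolicy.{u} (k + 1)) {α : ℝ} (hα : 0 ≤ α)
    (h : ∀ (M : ℕ) (π : Equiv.Perm (Fin (k + 1))),
      cost α (nsw (k + 1)) A (nestedSeq M π) ≤ 0) :
    α ≤ (1 / ((k + 1)! : ℝ)) ^ (1 / ((k + 1 : ℕ) : ℝ)) := by
  set c := (1 / ((k + 1)! : ℝ)) ^ (1 / ((k + 1 : ℕ) : ℝ)) with hc
  have hM : ∀ M : ℕ, α ≤ c * (1 + ((k : ℝ) + 1) * (1 / ((M : ℝ) + 1))) := by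
    intro M
    -- Yao's principle: sum the guarantees over all orders, then exchange sum and integral to bound
    -- each seed's deterministic policy separately.
    have h1 : ∑ _π : Equiv.Perm (Fin (k + 1)), α * nestedOpt k M ≤
        ∑ π : Equiv.Perm (Fin (k + 1)),
          ∫ ω, nsw (k + 1) ((A.policy ω).load (nestedSeq M π)) ∂A.law :=
      Finset.sum_le_sum fun π _ => (mul_le_mul_of_nonneg_left (nestedOpt_le_optValue M π) hα).trans
        (sub_nonpos.1 (h M π))
    rw [← integral_finsetSum _ fun π _ => A.integrable_nsw_load _] at h1
    have h2 := h1.trans (integral_mono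
      (integrable_finsetSum _ fun π _ => A.integrable_nsw_load _) (integrable_const _)
      fun ω => (A.policy ω).sum_perm_nsw_nestedSeq_le M)
    rw [Finset.sum_const, Finset.card_univ, Fintype.card_perm, Fintype.card_fin, nsmul_eq_mul,
      integral_const, probReal_univ, one_smul] at h2
    have h3 := le_of_mul_le_mul_left h2 (by positivity)
    rw [mul_right_comm] at h3
    have h4 := le_of_mul_le_mul_right h3 (nestedOpt_pos M)
    rwa [div_eq_mul_one_div ((k : ℝ) + 1)] at h4
  have hlim : Tendsto (fun M : ℕ => c * (1 + ((k : ℝ) + 1) * (1 / ((M : ℝ) + 1)))) atTop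
      (𝓝 (c * (1 + ((k : ℝ) + 1) * 0))) :=
    ((tendsto_one_div_add_atTop_nhds_zero_nat.const_mul _).const_add _).const_mul _
  rw [mul_zero, add_zero, mul_one] at hlim
  exact ge_of_tendsto' hlim hM

theorem nestedSeq_mem_requestSeqs {k : ℕ} (M : ℕ) (π : Equiv.Perm (Fin (k + 1))) :
    nestedSeq M π ∈ requestSeqs (k + 1) (k + 1) (∑ t ∈ Finset.range (k + 1), ((M : ℝ) + 1) ^ t) := by
  refine ⟨by simp [nestedSeq], ?_⟩
  rw [nestedSeq, List.map_map, Finset.sum_range]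
  exact (Fin.sum_univ_def _).trans (by simp [← List.map_coe_finRange_eq_range]; rfl) |>.symm

theorem sum_pow_pos (k M : ℕ) : 0 < ∑ t ∈ Finset.range (k + 1), ((M : ℝ) + 1) ^ t :=
  Finset.sum_pos (fun _ _ => by positivity) (by simp)

theorem competitiveRatio_nsw_le {n : ℕ} (hn : 1 ≤ n) (A : RandomizedPolicy.{u} n) :
    competitiveRatio (nsw n) A ≤ ENNReal.ofReal ((1 / (n ! : ℝ)) ^ (1 / (n : ℝ))) := by
  obtain ⟨k, rfl⟩ := Nat.exists_eq_add_of_le' hn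
  refine iSup_le fun α => iSup_le fun hα => iSup_le fun h => ?_
  simp only [regret, iSup_le_iff] at h
  rw [ENNReal.coe_nnreal_eq]
  refine ENNReal.ofReal_le_ofReal (le_of_forall_nestedSeq A α.2 fun M π => ?_)
  have h1 := h (k + 1) _ (sum_pow_pos k M) _ (nestedSeq_mem_requestSeqs M π)
  exact_mod_cast h1

theorem adaptiveCompetitiveRatio_nsw_le {n : ℕ} (hn : 1 ≤ n) (A : RandomizedPolicy.{u} n) :
    adaptiveCompetitiveRatio (nsw n) A ≤ ENNReal.ofReal ((1 / (n ! : ℝ)) ^ (1 / (n : ℝ))) := by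
  obtain ⟨k, rfl⟩ := Nat.exists_eq_add_of_le' hn
  refine iSup_le fun α => iSup_le fun hα => iSup_le fun h => ?_
  simp only [adaptiveRegret, iSup_le_iff] at h
  rw [ENNReal.coe_nnreal_eq]
  refine ENNReal.ofReal_le_ofReal (le_of_forall_nestedSeq A α.2 fun M π => ?_)
  have hplay : ∀ ω, (A.policy ω).play (fun h => nestedRequest M π h.length) (k + 1) =
      (A.policy ω).run (nestedSeq M π) := fun ω => (A.policy ω).play_length _ _
  have hmem : (fun h => nestedRequest M π h.length) ∈ adaptiveSeqs (nsw (k + 1)) A (k + 1)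
      (∑ t ∈ Finset.range (k + 1), ((M : ℝ) + 1) ^ t) := by
    refine ⟨Eventually.of_forall fun ω => ?_, ?_, ?_⟩
    · rw [hplay, Policy.requests_run]
      exact nestedSeq_mem_requestSeqs M π
    · simp only [hplay, Policy.requests_run]
      exact integrable_const _
    · simp only [hplay]
      exact A.integrable_nsw_load _
  have h1 := h (k + 1) _ (sum_pow_pos k M) _ hmem
  have h2 : adaptiveCost α (nsw (k + 1)) A (k + 1) (fun h => nestedRequest M π h.length) =
      cost α (nsw (k + 1)) A (nestedSeq M π) := by
    simp only [adaptiveCost, hplay, Policy.requests_run]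
    refine (integral_sub (integrable_const _) (A.integrable_nsw_load (nestedSeq M π))).trans ?_
    rw [integral_const, probReal_univ, one_smul]
    rfl
  rw [← h2]
  exact_mod_cast h1

theorem competitiveRatio_waterFilling {n : ℕ} (hn : 1 ≤ n) :
    competitiveRatio (nsw n) (waterFilling n).toRandomized =
      ENNReal.ofReal ((1 / (n ! : ℝ)) ^ (1 / (n : ℝ))) :=
  le_antisymm (competitiveRatio_nsw_le hn _) le_competitiveRatio_waterFilling

theorem adaptiveCompetitiveRatio_waterFilling {n : ℕ} (hn : 1 ≤ n) :
    adaptiveCompetitiveRatio (nsw n) (waterFilling n).toRandomized =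
      ENNReal.ofReal ((1 / (n ! : ℝ)) ^ (1 / (n : ℝ))) :=
  le_antisymm (adaptiveCompetitiveRatio_nsw_le hn _) le_adaptiveCompetitiveRatio_waterFilling

/-! ### Asymptotics of the ratio -/

/-- `n / (n!) ^ (1 / n)` tends to `e`. -/
theorem tendsto_mul_one_div_factorial_rpow :
    Tendsto (fun n : ℕ => (n : ℝ) * (1 / (n ! : ℝ)) ^ (1 / (n : ℝ))) atTop
      (𝓝 (Real.exp 1)) := by
  have h1 : Tendsto (fun n : ℕ => Real.log (Stirling.stirlingSeq n) / n) atTop (𝓝 0) :=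
    ((Real.continuousAt_log (by positivity)).tendsto.comp
      Stirling.tendsto_stirlingSeq_sqrt_pi).div_atTop tendsto_natCast_atTop_atTop
  have h2 : Tendsto (fun n : ℕ => Real.log (2 * n) / (2 * n)) atTop (𝓝 0) := by
    have h : Tendsto (fun n : ℕ => (2 : ℝ) * n) atTop atTop :=
      tendsto_natCast_atTop_atTop.const_mul_atTop (by norm_num)
    exact Real.isLittleO_log_id_atTop.tendsto_div_nhds_zero.comp h
  -- By the definition of `stirlingSeq`, this expression is `log n - log (n!) / n` for `n > 0`. The
  -- first correction vanishes because `stirlingSeq` converges to the positive limit `√π`.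
  have h3 : Tendsto (fun n : ℕ => 1 - Real.log (Stirling.stirlingSeq n) / n -
      Real.log (2 * n) / (2 * n)) atTop (𝓝 1) := by
    simpa using (h1.const_sub 1).sub h2
  refine ((Real.continuous_exp.tendsto 1).comp h3).congr' ?_
  filter_upwards [eventually_gt_atTop 0] with n hn
  have hn' : (0 : ℝ) < n := by exact_mod_cast hn
  have h4 : (n : ℝ) * (1 / (n ! : ℝ)) ^ (1 / (n : ℝ)) =
      Real.exp (Real.log n - Real.log (n ! : ℝ) / n) := by
    rw [Real.exp_sub, Real.exp_log hn', one_div, Real.inv_rpow (by positivity),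
      Real.rpow_def_of_pos (by positivity), mul_one_div, ← div_eq_mul_inv]
  rw [h4, Function.comp_apply, Stirling.log_stirlingSeq_formula,
    Real.log_div hn'.ne' (Real.exp_pos 1).ne', Real.log_exp]
  congr 1
  field_simp
  ring

end OnlineAllocation

theorem mainTheorem11 :
    (∀ n : ℕ, 1 ≤ n →
      (∀ A : OnlineAllocation.RandomizedPolicy.{u} n,
        OnlineAllocation.competitiveRatio (OnlineAllocation.nsw n) A ≤
          OnlineAllocation.competitiveRatio (OnlineAllocation.nsw n)
            (OnlineAllocation.waterFilling n).toRandomized) ∧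
      (∀ A : OnlineAllocation.RandomizedPolicy.{u} n,
        OnlineAllocation.adaptiveCompetitiveRatio (OnlineAllocation.nsw n) A ≤
          OnlineAllocation.adaptiveCompetitiveRatio (OnlineAllocation.nsw n)
            (OnlineAllocation.waterFilling n).toRandomized) ∧
      OnlineAllocation.competitiveRatio (OnlineAllocation.nsw n)
          (OnlineAllocation.waterFilling n).toRandomized =
        ENNReal.ofReal ((1 / (n ! : ℝ)) ^ (1 / (n : ℝ))) ∧
      OnlineAllocation.adaptiveCompetitiveRatio (OnlineAllocation.nsw n)
          (OnlineAllocation.waterFilling n).toRandomized =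
        ENNReal.ofReal ((1 / (n ! : ℝ)) ^ (1 / (n : ℝ)))) ∧
    Tendsto (fun n : ℕ => (n : ℝ≥0∞) *
        OnlineAllocation.competitiveRatio (OnlineAllocation.nsw n)
          (OnlineAllocation.waterFilling n).toRandomized)
      atTop (𝓝 (ENNReal.ofReal (Real.exp 1))) := by
  refine ⟨fun n hn => ?_, ?_⟩
  · rw [OnlineAllocation.competitiveRatio_waterFilling hn,
      OnlineAllocation.adaptiveCompetitiveRatio_waterFilling hn]
    exact ⟨OnlineAllocation.competitiveRatio_nsw_le hn,
      OnlineAllocation.adaptiveCompetitiveRatio_nsw_le hn, rfl, rfl⟩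
  · refine (ENNReal.tendsto_ofReal
      OnlineAllocation.tendsto_mul_one_div_factorial_rpow).congr' ?_
    filter_upwards [eventually_ge_atTop 1] with n hn
    rw [OnlineAllocation.competitiveRatio_waterFilling hn, ENNReal.ofReal_mul (by positivity),
      ENNReal.ofReal_natCast]
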